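/- **Proposition 4.2 (adjoint action, homological equation).** Let $I=\mathbb Z\times\{+1,-1\}$, and for $k=(j,\sigma)\in I$ put $\langle k\rangle=\max(|j|,1)$ and $\mathfrak m_k=\sigma j$. For $s>0$ let $\mathtt g_s$ be the space of $x\in\mathbb C^I$ with $|x|_s:=\big(\sum_{k}\langle k\rangle^2e^{2s\sqrt{\langle k\rangle}}|x_k|^2\big)^{1/2}<\infty$, and for $r>0$ let $B_r(\mathtt g_s)$ be its open ball of radius $r$ centred at $0$. For a formal vector field $V=\sum_{k\in I}\sum_{q\in\mathbb N^I_{\rm fin}}V^{(k)}_q x^q\partial_{x_k}$ put $$\|V\|_{s,r}:=\frac1r\sup_{x\in B_r(\mathtt g_s)}\big|\underline V(x)\big|_s\in[0,\infty],\qquad \underline V:=\sum_{k,q}|V_q^{(k)}|\,x^q\partial_{x_k}.$$ Let $\mathcal V_{s,r}$ be the set of those $V$ with $V(0)=0$, with $V_q^{(k)}=0$ whenever $\mathfrak m\cdot(q-e_k)\neq0$, and with $\|V\|_{s,r}<\infty$. For $\lambda\in\mathbb C^I$ let $L_\lambda V:=[\mathtt D(\lambda),V]$ with $\mathtt D(\lambda)=\sum_k\lambda_kx_k\partial_{x_k}$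 and $[X,Y]=\sum_j\big(X[Y^{(j)}]-Y[X^{(j)}]\big)\partial_{x_j}$, so that $L_\lambda(x^q\partial_{x_k})=\lambda\cdot(q-e_k)\,x^q\partial_{x_k}$; it takes values in formal vector fields. Let $$\mathcal R_{s,r}:=\{V\in\mathcal V_{s,r}:\ V^{(k)}_q=0\ \text{whenever}\ \lambda\cdot(q-e_k)=0\},$$ the complement in $\mathcal V_{s,r}$ of the kernel of $L_\lambda$. Let $\Delta_\lambda$ be the set of finitely supported $P\in\mathbb Z^I$ with $\lambda\cdot P=0$, $\mathfrak m\cdot P=0$ and $P+e_k\in\mathbb N^I$ for some $k\in I$. Let $\tau>0$ and $C>0$. Then there are constants $\mathtt c>0$ and $K>0$, depending only on $\tau$ and $C$, such that the following holds for every $\gamma>0$ and every $\lambda\in\mathbb C^I$ satisfying: 1. $\lambda_k\ne0$ for all $k\in I$; 2. there are $\varphi_k\in\mathbb R$ $(k\in I)$ with $|\lambda_k-\langle k\rangle^2e^{i\varphi_k}|\le\frac12$ for all $k\in I$, and with $|e^{i\varphi_{(j,\sigma)}}-e^{i\varphi_{(-j,-\sigma)}}|\ge C$ for all $(j,\sigma)\in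 I$ such that $\lambda_{(j,\sigma)}\neq\lambda_{(-j,-\sigma)}$; 3. $\lambda$ is $(\gamma,\tau)$-Diophantine modulo $\Delta_\lambda$: $|\lambda\cdot p|\ge\gamma\prod_{i\in I}(1+p_i^2\langle i\rangle^2)^{-\tau}$ for all finitely supported $p\in\mathbb Z^I\setminus\Delta_\lambda$ with $\mathfrak m\cdot p=0$ and $p+e_k\in\mathbb N^I$ for some $k\in I$. For all $s,r>0$ and every $Y\in\mathcal R_{s,r}$ there is a formal vector field $X$ with $L_\lambda X=Y$ such that, for every $\delta>0$, $X$ belongs to $\mathcal R_{s+\delta,r}$, it is the only solution of $L_\lambda X=Y$ in $\mathcal R_{s+\delta,r}$, and $$\|X\|_{s+\delta,r}\le K\,e^{\mathtt c/\delta^6}\,\gamma^{-1}\,\|Y\|_{s,r}.$$ -/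

import Mathlib

open scoped ENNReal

noncomputable section

namespace AnalyticVF

/-- The index set `I = ℤ × {+1, -1}` (recall that `ℤˣ = {1, -1}`). -/
abbrev Idx : Type := ℤ × ℤˣ

/-- `⟨(j, σ)⟩ = max (|j|, 1)`. -/
def jap (k : Idx) : ℝ := max |(k.1 : ℝ)| 1

/-- The momentum `𝔪_(j, σ) = σ j`. -/
def mom (k : Idx) : ℤ := (k.2 : ℤ) * k.1

/-- `𝔪 · p` for a finitely supported integer vector `p`. -/
def momDot (p : Idx →₀ ℤ) : ℤ := p.sum fun i a => mom i * a

/-- `lam · p` for a finitely supported integer vector `p`. -/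
def freqDot (lam : Idx → ℂ) (p : Idx →₀ ℤ) : ℂ := p.sum fun i a => lam i * (a : ℂ)

/-- The vector `q - e_k`, for `q` a finitely supported vector of natural numbers. -/
def subUnit (q : Idx →₀ ℕ) (k : Idx) : Idx →₀ ℤ :=
  q.mapRange (fun n : ℕ => (n : ℤ)) Nat.cast_zero - Finsupp.single k 1

/-- Formal vector fields `V = ∑_k V^(k)(x) ∂/∂x_k`: each component is a formal power series in the
variables `(x_k)_{k ∈ I}`, and `V_q^(k) = MvPowerSeries.coeff q (V k)`. -/
abbrev FormalVF : Type := Idx → MvPowerSeries Idx ℂ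

/-- The action `X[f] = ∑_k X^(k) ∂f/∂x_k` of a vector field on a power series, the sum being taken
coefficient by coefficient.  It is used only where each coefficient is a finite sum. -/
def applyVF (X : FormalVF) (f : MvPowerSeries Idx ℂ) : MvPowerSeries Idx ℂ :=
  fun q => ∑ᶠ k : Idx, MvPowerSeries.coeff q (X k * MvPowerSeries.pderiv ℂ k f)

/-- The Lie bracket `[X, Y] = ∑_j (X[Y^(j)] - Y[X^(j)]) ∂/∂x_j`. -/
def lieBracket (X Y : FormalVF) : FormalVF :=
  fun j => applyVF X (Y j) - applyVF Y (X j)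

/-- The diagonal linear vector field `D(lam) = ∑_k lam_k x_k ∂/∂x_k`. -/
def diagVF (lam : Idx → ℂ) : FormalVF :=
  fun k => MvPowerSeries.monomial (Finsupp.single k 1) (lam k)

/-- The operator `L_lam Y = [D(lam), Y]`, with values in formal vector fields. -/
def lieDiag (lam : Idx → ℂ) (Y : FormalVF) : FormalVF := lieBracket (diagVF lam) Y

theorem freqDot_subUnit (lam : Idx → ℂ) (q : Idx →₀ ℕ) (k : Idx) :
    freqDot lam (subUnit q k) = (q.sum fun i n => lam i * (n : ℂ)) - lam k := by
  unfold freqDot subUnit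
  rw [Finsupp.sum_sub_index (by intros; push_cast; ring), Finsupp.sum_mapRange_index (by simp),
    Finsupp.sum_single_index (by simp)]
  simp

/-- `L_lam` acts diagonally on monomials: `(L_lam Y)_q^(k) = lam · (q - e_k) Y_q^(k)`. -/
theorem coeff_lieDiag (lam : Idx → ℂ) (Y : FormalVF) (k : Idx) (q : Idx →₀ ℕ) :
    MvPowerSeries.coeff q (lieDiag lam Y k)
      = freqDot lam (subUnit q k) * MvPowerSeries.coeff q (Y k) := by
  have h1 : MvPowerSeries.coeff q (applyVF (diagVF lam) (Y k))
      = (q.sum fun i n => lam i * (n : ℂ)) * MvPowerSeries.coeff q (Y k) := by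
    have e : ∀ i : Idx, MvPowerSeries.coeff q (diagVF lam i * MvPowerSeries.pderiv ℂ i (Y k))
        = lam i * (q i : ℂ) * MvPowerSeries.coeff q (Y k) := by
      intro i
      unfold diagVF
      rw [MvPowerSeries.coeff_monomial_mul]
      by_cases hi : q i = 0
      · rw [if_neg, hi]
        · simp
        · intro h
          have := h i
          simp [hi] at this
      · have hle : Finsupp.single i 1 ≤ q := by
          rw [Finsupp.single_le_iff]; omega
        rw [if_pos hle]
        rw [MvPowerSeries.coeff_pderiv, tsub_add_cancel_of_le hle, Finsupp.tsub_apply,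
          Finsupp.single_eq_same, Nat.cast_sub (by omega)]
        push_cast
        ring
    change (∑ᶠ i : Idx, MvPowerSeries.coeff q (diagVF lam i * MvPowerSeries.pderiv ℂ i (Y k))) = _
    simp_rw [e]
    rw [finsum_eq_sum_of_support_subset (s := q.support), Finsupp.sum, Finset.sum_mul]
    intro i hi
    rw [Function.mem_support] at hi
    simp only [Finset.mem_coe, Finsupp.mem_support_iff]
    intro h
    simp [h] at hi
  have h2 : MvPowerSeries.coeff q (applyVF Y (diagVF lam k))
      = lam k * MvPowerSeries.coeff q (Y k) := by
    have e : ∀ i : Idx, MvPowerSeries.pderiv ℂ i (diagVF lam k)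
        = if i = k then MvPowerSeries.C (lam k) else 0 := by
      intro i
      ext m
      rw [MvPowerSeries.coeff_pderiv]
      unfold diagVF
      rw [MvPowerSeries.coeff_monomial]
      by_cases hik : i = k
      · subst hik
        rw [if_pos rfl, MvPowerSeries.coeff_C]
        by_cases hm : m = 0
        · subst hm; simp
        · simp [hm]
      · rw [if_neg hik, if_neg]
        · simp
        · intro h
          have := DFunLike.congr_fun h i
          simp [Ne.symm hik] at this
    change (∑ᶠ i : Idx, MvPowerSeries.coeff q (Y i * MvPowerSeries.pderiv ℂ i (diagVF lam k))) = _
    rw [finsum_eq_single _ k]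
    · rw [e k, if_pos rfl, MvPowerSeries.coeff_mul_C, mul_comm]
    · intro i hi
      rw [e i, if_neg hi]
      simp
  have h3 : MvPowerSeries.coeff q (lieDiag lam Y k)
      = MvPowerSeries.coeff q (applyVF (diagVF lam) (Y k))
        - MvPowerSeries.coeff q (applyVF Y (diagVF lam k)) := rfl
  rw [h3, h1, h2, freqDot_subUnit]
  ring

/-- The norm of the weighted space `g_s`, for a sequence `a` of absolute values:
`(∑_k ⟨k⟩² e^{2 s √⟨k⟩} a_k²)^{1/2}`, possibly infinite. -/
def gNorm (s : ℝ) (a : Idx → ℝ≥0∞) : ℝ≥0∞ :=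
  (∑' k : Idx, ENNReal.ofReal (jap k ^ 2 * Real.exp (2 * s * √(jap k))) * a k ^ 2) ^ (1 / 2 : ℝ)

/-- The open ball `B_r(g_s)`. -/
def gBall (s r : ℝ) : Set (Idx → ℂ) :=
  {x | gNorm s (fun k => ‖x k‖ₑ) < ENNReal.ofReal r}

/-- The components `∑_q |V_q^(k)| |x^q|` of the majorant field of `V` at `(|x_k|)_k`. -/
def majorant (V : FormalVF) (x : Idx → ℂ) (k : Idx) : ℝ≥0∞ :=
  ∑' q : Idx →₀ ℕ, ‖MvPowerSeries.coeff q (V k)‖ₑ * q.prod fun h n => ‖x h‖ₑ ^ n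

/-- The majorant norm `‖V‖_{s,r} = r⁻¹ sup_{x ∈ B_r(g_s)} |V̲(x)|_s` with values in `[0, ∞]`, where
`V̲` is the vector field with coefficients `|V_q^(k)|`.  Since the ball is invariant under
`x ↦ (|x_k|)_k`, and `|V̲(x)|_s` is largest at points with nonnegative entries, the supremum may be
computed with `|x_k|` in place of `x_k`; then all series have nonnegative terms. -/
def majNorm (s r : ℝ) (V : FormalVF) : ℝ≥0∞ :=
  (ENNReal.ofReal r)⁻¹ * ⨆ x ∈ gBall s r, gNorm s (majorant V x)

/-- The space `𝒱_{s,r}`: vector fields that vanish at the origin, preserve momentum and have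
finite majorant norm. -/
def admissible (s r : ℝ) : Set FormalVF :=
  {V | (∀ k, MvPowerSeries.coeff 0 (V k) = 0) ∧
    (∀ k q, momDot (subUnit q k) ≠ 0 → MvPowerSeries.coeff q (V k) = 0) ∧
    majNorm s r V < ∞}

/-- The complement `ℛ_{s,r}` in `𝒱_{s,r}` of the kernel of `L_lam`: the fields in `𝒱_{s,r}` that
contain no monomial `x^q ∂/∂x_k` with `lam · (q - e_k) = 0`. -/
def rangeSpace (lam : Idx → ℂ) (s r : ℝ) : Set FormalVF :=
  {V | V ∈ admissible s r ∧
    ∀ k q, freqDot lam (subUnit q k) = 0 → MvPowerSeries.coeff q (V k) = 0}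

/-- The resonance module
`Δ_lam = {P : lam · P = 0, 𝔪 · P = 0, P + e_k ∈ ℕ^I for some k}`. -/
def resonances (lam : Idx → ℂ) : Set (Idx →₀ ℤ) :=
  {P | freqDot lam P = 0 ∧ momDot P = 0 ∧ ∃ k, 0 ≤ P + Finsupp.single k 1}

/-- `lam` is `(γ, τ)`-Diophantine modulo `Δ_lam`.  Factors with `p_i = 0` are equal to `1`. -/
def IsDiophantine (lam : Idx → ℂ) (γ τ : ℝ) : Prop :=
  ∀ p : Idx →₀ ℤ, p ∉ resonances lam → momDot p = 0 →
    (∃ k, 0 ≤ p + Finsupp.single k 1) →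
      γ * (p.prod fun i a => 1 / (1 + (a : ℝ) ^ 2 * jap i ^ 2) ^ τ) ≤ ‖freqDot lam p‖

/-- Superlinear frequencies (with exponent `2` and separation constant `C`): there are phases
`φ_k` with `|lam_k - ⟨k⟩² e^{i φ_k}| ≤ 1/2`, and `|e^{i φ_(j,σ)} - e^{i φ_(-j,-σ)}| ≥ C`
whenever `lam_(j,σ) ≠ lam_(-j,-σ)`. -/
def IsSuperlinear (lam : Idx → ℂ) (C : ℝ) : Prop :=
  ∃ φ : Idx → ℝ,
    (∀ k, ‖lam k - (jap k : ℂ) ^ 2 * Complex.exp (Complex.I * φ k)‖ ≤ 1 / 2) ∧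
    ∀ (j : ℤ) (σ : ℤˣ), lam (j, σ) ≠ lam (-j, -σ) →
      C ≤ ‖Complex.exp (Complex.I * φ (j, σ)) - Complex.exp (Complex.I * φ (-j, -σ))‖

end AnalyticVF

end

open AnalyticVF

namespace AnalyticVF

/-! ### The weights `⟨k⟩` and the momentum -/

/-! `L_lam` is diagonal on monomials, so the only solution without resonant monomials divides each
coefficient of Y by λ·(q - e_k). Passing from g_s to g_{s+δ} multiplies the monomial x^q ∂_{x_k} by
exp(-δ(∑ q_i √⟨i⟩ - √⟨k⟩)) (`majNorm_add_le`). Everything thus reduces to showing that this gain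
beats the small divisor, which is `inv_norm_freqDot_le`.

Write q = q' + e_a with ⟨a⟩ maximal and put T = ∑ q'_i √⟨i⟩. Conservation of momentum makes the
exponent of the gain at least δT/2 (`sqrt_jap_le_of_momDot`), so the divisor must be controlled by
q' alone. If the divisor is at least 1, it is enough that γ⁻¹ is bounded below. Otherwise
superlinearity and momentum (`cancel_or_jap_le`) leave two cases. Either λ_a and λ_k cancel, and the
Diophantine condition applies to q' itself; or ⟨a⟩ and ⟨k⟩ are O(1 + T⁴), and the two extra indices
cost only a power of 1 + T⁴.

The Diophantine weight of q' is a product over arbitrarily many modes. Each factor is bounded by the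
exponential of its share of δT/4 plus an error O(δ⁻⁶ ⟨i⟩^(-5/4)). These errors are summable over i,
which gives exp(c/δ⁶) (`dioWeight_toInt_rpow_le`). The remaining δT/4 absorbs the power of 1 + T⁴.
-/

theorem one_le_jap (k : Idx) : 1 ≤ jap k := le_max_right _ _

theorem jap_pos (k : Idx) : 0 < jap k := lt_of_lt_of_le one_pos (one_le_jap k)

theorem jap_eq_intCast (k : Idx) : jap k = ((max |k.1| 1 : ℤ) : ℝ) := by
  simp [jap]

theorem abs_mom (k : Idx) : |mom k| = |k.1| := by
  rcases Int.units_eq_one_or k.2 with h | h <;> simp [mom, h]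

theorem abs_mom_le_jap (k : Idx) : |(mom k : ℝ)| ≤ jap k := by
  rw [← Int.cast_abs, abs_mom, Int.cast_abs]
  exact le_max_left _ _

/-- The weights are integers, so distinct ones differ by at least 1; factor the difference of
squares. -/
theorem jap_add_le_abs_sq_sub_sq {a k : Idx} (h : jap a ≠ jap k) :
    jap a + jap k ≤ |jap a ^ 2 - jap k ^ 2| := by
  have h1 : (1 : ℝ) ≤ |jap a - jap k| := by
    rw [jap_eq_intCast, jap_eq_intCast] at *
    have : (max |a.1| 1 - max |k.1| 1 : ℤ) ≠ 0 := fun h0 => h (by rw [sub_eq_zero.1 h0])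
    exact_mod_cast Int.one_le_abs this
  have h2 : 0 < jap a + jap k := add_pos (jap_pos a) (jap_pos k)
  rw [sq_sub_sq, abs_mul, abs_of_pos h2]
  exact le_mul_of_one_le_right h2.le h1

/-! ### Linear functionals on finitely supported vectors -/

/-- A vector of natural numbers, seen as a vector of integers. -/
noncomputable def toInt (q : Idx →₀ ℕ) : Idx →₀ ℤ := q.mapRange (fun n : ℕ => (n : ℤ)) Nat.cast_zero

theorem toInt_nonneg (q : Idx →₀ ℕ) : 0 ≤ toInt q := fun _ => Int.natCast_nonneg _

theorem subUnit_eq (q : Idx →₀ ℕ) (k : Idx) : subUnit q k = toInt q - Finsupp.single k 1 := rfl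

theorem subUnit_add_single (q : Idx →₀ ℕ) (a k : Idx) :
    subUnit (q + Finsupp.single a 1) k
      = toInt q + Finsupp.single a 1 - Finsupp.single k 1 := by
  ext i
  simp only [subUnit_eq, toInt, Finsupp.coe_sub, Finsupp.coe_add, Pi.sub_apply, Pi.add_apply,
    Finsupp.mapRange_apply, Finsupp.single_apply]
  push_cast
  rfl

theorem momDot_add (p p' : Idx →₀ ℤ) : momDot (p + p') = momDot p + momDot p' :=
  Finsupp.sum_add_index' (by simp) (by intros; ring)

theorem momDot_sub (p p' : Idx →₀ ℤ) : momDot (p - p') = momDot p - momDot p' :=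
  Finsupp.sum_sub_index (by intros; ring)

theorem momDot_single (k : Idx) : momDot (Finsupp.single k 1) = mom k := by
  simp [momDot]

theorem freqDot_add (lam : Idx → ℂ) (p p' : Idx →₀ ℤ) :
    freqDot lam (p + p') = freqDot lam p + freqDot lam p' :=
  Finsupp.sum_add_index' (by simp) (by intros; push_cast; ring)

theorem freqDot_sub (lam : Idx → ℂ) (p p' : Idx →₀ ℤ) :
    freqDot lam (p - p') = freqDot lam p - freqDot lam p' :=
  Finsupp.sum_sub_index (by intros; push_cast; ring)

theorem freqDot_single (lam : Idx → ℂ) (k : Idx) :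
    freqDot lam (Finsupp.single k 1) = lam k := by
  simp [freqDot]

theorem momDot_toInt (q : Idx →₀ ℕ) : momDot (toInt q) = q.sum fun i n => mom i * (n : ℤ) :=
  Finsupp.sum_mapRange_index (by simp)

theorem freqDot_toInt (lam : Idx → ℂ) (q : Idx →₀ ℕ) :
    freqDot lam (toInt q) = q.sum fun i n => lam i * (n : ℂ) := by
  unfold freqDot toInt
  rw [Finsupp.sum_mapRange_index (by simp)]
  simp

/-- The weighted degree `∑_i q_i √⟨i⟩`. -/
noncomputable def sqrtDeg (q : Idx →₀ ℕ) : ℝ := q.sum fun i n => (n : ℝ) * √(jap i)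

theorem sqrtDeg_nonneg (q : Idx →₀ ℕ) : 0 ≤ sqrtDeg q :=
  Finset.sum_nonneg fun _ _ => by positivity

theorem sqrtDeg_add_single (q : Idx →₀ ℕ) (a : Idx) :
    sqrtDeg (q + Finsupp.single a 1) = sqrtDeg q + √(jap a) := by
  unfold sqrtDeg
  rw [Finsupp.sum_add_index' (by simp) (by intros; push_cast; ring)]
  simp

theorem sqrt_jap_le_sqrtDeg {q : Idx →₀ ℕ} {i : Idx} (hi : i ∈ q.support) :
    √(jap i) ≤ sqrtDeg q := by
  have h1 : (1 : ℝ) ≤ q i := by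
    exact_mod_cast Nat.one_le_iff_ne_zero.2 (Finsupp.mem_support_iff.1 hi)
  calc √(jap i) ≤ (q i : ℝ) * √(jap i) := le_mul_of_one_le_left (Real.sqrt_nonneg _) h1
    _ ≤ sqrtDeg q := Finset.single_le_sum (f := fun i => (q i : ℝ) * √(jap i))
        (fun _ _ => by positivity) hi

/-- Every √⟨i⟩ with i in the support is at most `sqrtDeg q`, so m of the m + 1 factors can be pulled
out of the sum. The case m = 1 controls momenta and m = 3 controls frequencies. -/
theorem sum_sqrt_jap_pow_le (q : Idx →₀ ℕ) (m : ℕ) :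
    (q.sum fun i n => (n : ℝ) * √(jap i) ^ (m + 1)) ≤ sqrtDeg q ^ (m + 1) := by
  rw [pow_succ', Finsupp.sum]
  conv_rhs => rw [sqrtDeg]
  rw [Finsupp.sum, Finset.sum_mul]
  refine Finset.sum_le_sum fun i hi => ?_
  rw [pow_succ', ← mul_assoc]
  have : √(jap i) ≤ ∑ j ∈ q.support, (q j : ℝ) * √(jap j) := sqrt_jap_le_sqrtDeg hi
  gcongr

theorem sum_jap_le (q : Idx →₀ ℕ) : (q.sum fun i n => (n : ℝ) * jap i) ≤ sqrtDeg q ^ 2 := by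
  have := sum_sqrt_jap_pow_le q 1
  simpa only [Nat.reduceAdd, Real.sq_sqrt (jap_pos _).le] using this

theorem sum_jap_sq_le (q : Idx →₀ ℕ) :
    (q.sum fun i n => (n : ℝ) * jap i ^ 2) ≤ sqrtDeg q ^ 4 := by
  have h : ∀ i, √(jap i) ^ 4 = jap i ^ 2 := fun i => by
    rw [show (4 : ℕ) = 2 * 2 from rfl, pow_mul, Real.sq_sqrt (jap_pos _).le]
  have := sum_sqrt_jap_pow_le q 3
  simpa only [Nat.reduceAdd, h] using this

theorem abs_momDot_toInt_le (q : Idx →₀ ℕ) :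
    |(momDot (toInt q) : ℝ)| ≤ q.sum fun i n => (n : ℝ) * jap i := by
  rw [momDot_toInt, Finsupp.sum, Int.cast_sum]
  refine (Finset.abs_sum_le_sum_abs _ _).trans (Finset.sum_le_sum fun i _ => ?_)
  push_cast
  rw [abs_mul, Nat.abs_cast, mul_comm]
  exact mul_le_mul_of_nonneg_left (abs_mom_le_jap i) (Nat.cast_nonneg _)

/-- If momentum is preserved, the output index contributes less to the weighted degree than the
largest input index plus half of the remaining ones. -/
theorem sqrt_jap_le_of_momDot {q : Idx →₀ ℕ} {a k : Idx} (ha : ∀ i ∈ q.support, jap i ≤ jap a)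
    (hm : momDot (toInt q + Finsupp.single a 1 - Finsupp.single k 1) = 0) :
    √(jap k) ≤ √(jap a) + sqrtDeg q / 2 := by
  set Q := q.sum fun i n => (n : ℝ) * jap i with hQ
  have hQ0 : 0 ≤ Q := Finset.sum_nonneg fun i _ => mul_nonneg (Nat.cast_nonneg _) (jap_pos i).le
  have hk : jap k ≤ jap a + Q := by
    rw [momDot_sub, momDot_add, momDot_single, momDot_single] at hm
    have hm' : (mom k : ℝ) = momDot (toInt q) + mom a := by
      exact_mod_cast (sub_eq_zero.1 hm).symm
    refine max_le ?_ ((one_le_jap a).trans (le_add_of_nonneg_right hQ0))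
    have h1 : |(k.1 : ℝ)| = |(mom k : ℝ)| := by
      rw [← Int.cast_abs, ← Int.cast_abs, abs_mom]
    rw [h1, hm']
    have := abs_add_le (momDot (toInt q) : ℝ) (mom a : ℝ)
    have := abs_momDot_toInt_le q
    have := abs_mom_le_jap a
    linarith
  have hQT : Q ≤ √(jap a) * sqrtDeg q := by
    rw [hQ, sqrtDeg, Finsupp.sum, Finsupp.sum, Finset.mul_sum]
    refine Finset.sum_le_sum fun i hi => ?_
    have h1 : √(jap i) ≤ √(jap a) := Real.sqrt_le_sqrt (ha i hi)
    nth_rewrite 1 [← Real.mul_self_sqrt (jap_pos i).le]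
    nlinarith [mul_nonneg (Nat.cast_nonneg (α := ℝ) (q i)) (Real.sqrt_nonneg (jap i))]
  have hT := sqrtDeg_nonneg q
  -- With T = `sqrtDeg q`, the square of √⟨a⟩ + T/2 is ⟨a⟩ + √⟨a⟩ T + T²/4, which dominates ⟨a⟩ + Q.
  refine Real.sqrt_le_iff.2 ⟨by positivity, ?_⟩
  have := Real.sq_sqrt (jap_pos a).le
  nlinarith [sq_nonneg (sqrtDeg q)]

/-! ### Separation of the two largest frequencies -/

theorem norm_le_of_superlinear {lam : Idx → ℂ} {φ : Idx → ℝ} {k : Idx}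
    (h : ‖lam k - (jap k : ℂ) ^ 2 * Complex.exp (Complex.I * φ k)‖ ≤ 1 / 2) :
    ‖lam k‖ ≤ 3 / 2 * jap k ^ 2 := by
  have h1 : ‖(jap k : ℂ) ^ 2 * Complex.exp (Complex.I * φ k)‖ = jap k ^ 2 := by
    rw [norm_mul, mul_comm Complex.I, Complex.norm_exp_ofReal_mul_I, norm_pow, Complex.norm_real,
      Real.norm_of_nonneg (jap_pos k).le, mul_one]
  have h2 := norm_le_norm_add_norm_sub' (lam k) ((jap k : ℂ) ^ 2 * Complex.exp (Complex.I * φ k))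
  have := one_le_pow₀ (one_le_jap k) (n := 2)
  linarith

theorem eq_or_eq_neg_of_mom_eq {a k : Idx} (h : mom a = mom k) : k = a ∨ k = (-a.1, -a.2) := by
  obtain ⟨j, σ⟩ := a
  obtain ⟨j', σ'⟩ := k
  simp only [mom, Prod.mk.injEq] at *
  rcases Int.units_eq_one_or σ with rfl | rfl <;> rcases Int.units_eq_one_or σ' with rfl | rfl <;>
    simp at h ⊢ <;> omega

/-- For superlinear frequencies and a small divisor, the largest input index and the output index
either cancel, or are controlled by the remaining input indices. -/
theorem cancel_or_jap_le {lam : Idx → ℂ} {C : ℝ} (hC : 0 < C) (hlam : IsSuperlinear lam C)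
    {q : Idx →₀ ℕ} {a k : Idx}
    (hm : momDot (toInt q + Finsupp.single a 1 - Finsupp.single k 1) = 0)
    (hf : ‖freqDot lam (toInt q + Finsupp.single a 1 - Finsupp.single k 1)‖ < 1) :
    (lam a = lam k ∧ mom a = mom k) ∨
      (jap a ≤ (2 + 2 / C) * (1 + sqrtDeg q ^ 4) ∧ jap k ≤ (2 + 2 / C) * (1 + sqrtDeg q ^ 4)) := by
  obtain ⟨φ, hφ, hsep⟩ := hlam
  have hT := sqrtDeg_nonneg q
  set T := sqrtDeg q
  have hq : ‖freqDot lam (toInt q)‖ ≤ 3 / 2 * T ^ 4 := by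
    have h1 : ‖freqDot lam (toInt q)‖ ≤ 3 / 2 * q.sum fun i n => (n : ℝ) * jap i ^ 2 := by
      rw [freqDot_toInt, Finsupp.sum, Finsupp.sum, Finset.mul_sum]
      refine (norm_sum_le _ _).trans (Finset.sum_le_sum fun i _ => ?_)
      rw [norm_mul, Complex.norm_natCast]
      have := norm_le_of_superlinear (hφ i)
      nlinarith [Nat.cast_nonneg (α := ℝ) (q i)]
    have := sum_jap_sq_le q
    linarith
  rw [freqDot_sub, freqDot_add, freqDot_single, freqDot_single] at hf
  rw [momDot_sub, momDot_add, momDot_single, momDot_single] at hm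
  set ea := Complex.exp (Complex.I * φ a) with hea
  set ek := Complex.exp (Complex.I * φ k) with hek
  have hna : ‖ea‖ = 1 := by rw [hea, mul_comm, Complex.norm_exp_ofReal_mul_I]
  have hnk : ‖ek‖ = 1 := by rw [hek, mul_comm, Complex.norm_exp_ofReal_mul_I]
  have hdiff : ‖(jap a : ℂ) ^ 2 * ea - (jap k : ℂ) ^ 2 * ek‖ ≤ 2 * (1 + T ^ 4) := by
    have e : (jap a : ℂ) ^ 2 * ea - (jap k : ℂ) ^ 2 * ek
        = (freqDot lam (toInt q) + lam a - lam k) - freqDot lam (toInt q)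
          - (lam a - (jap a : ℂ) ^ 2 * ea) + (lam k - (jap k : ℂ) ^ 2 * ek) := by ring
    rw [e]
    have h1 := norm_add_le ((freqDot lam (toInt q) + lam a - lam k) - freqDot lam (toInt q)
          - (lam a - (jap a : ℂ) ^ 2 * ea)) (lam k - (jap k : ℂ) ^ 2 * ek)
    have h2 := norm_sub_le ((freqDot lam (toInt q) + lam a - lam k) - freqDot lam (toInt q))
          (lam a - (jap a : ℂ) ^ 2 * ea)
    have h3 := norm_sub_le (freqDot lam (toInt q) + lam a - lam k) (freqDot lam (toInt q))
    have h4 := hφ a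
    have h5 := hφ k
    have : 0 ≤ T ^ 4 := by positivity
    linarith
  have hM : (2 + 2 / C) * (1 + T ^ 4) = 2 * (1 + T ^ 4) + 2 / C * (1 + T ^ 4) := by ring
  have h2C : 0 ≤ 2 / C * (1 + T ^ 4) := by positivity
  have h4 : 0 ≤ T ^ 4 := by positivity
  have hja := one_le_jap a
  have hjk := one_le_jap k
  -- For different weights the moduli ⟨a⟩² and ⟨k⟩² are already far apart, whatever the phases.
  by_cases hjap : jap a = jap k
  swap
  · right
    have h1 := jap_add_le_abs_sq_sub_sq hjap
    have h2 := abs_norm_sub_norm_le ((jap a : ℂ) ^ 2 * ea) ((jap k : ℂ) ^ 2 * ek)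
    rw [norm_mul, norm_mul, hna, hnk, norm_pow, norm_pow, Complex.norm_real, Complex.norm_real,
      Real.norm_of_nonneg (jap_pos a).le, Real.norm_of_nonneg (jap_pos k).le, mul_one,
      mul_one] at h2
    constructor <;> linarith
  suffices h : (lam a = lam k ∧ mom a = mom k) ∨ jap a ≤ (2 + 2 / C) * (1 + T ^ 4) by
    rwa [← hjap, and_self]
  -- The weight 1 is shared by j = 0 and |j| = 1. Away from it ⟨a⟩ = |𝔪_a|, so equal weights force
  -- 𝔪_a = ±𝔪_k.
  by_cases h1 : jap a = 1
  · right; linarith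
  -- Equal momenta with λ_a ≠ λ_k leave only k = (-j, -σ), where the phases are C apart; this
  -- produces 2/C. Opposite momenta give 2|𝔪_a| = |𝔪·q| ≤ T².
  by_cases hmom : mom a = mom k
  · rw [or_iff_not_imp_left]
    intro hne
    have hlne : lam a ≠ lam k := fun h => hne ⟨h, hmom⟩
    have hka : k = (-a.1, -a.2) :=
      (eq_or_eq_neg_of_mom_eq hmom).resolve_left fun h => hlne (by rw [h])
    have h2 : C ≤ ‖ea - ek‖ := by
      have := hsep a.1 a.2
      rw [← hka] at this
      exact this hlne
    rw [← hjap, ← mul_sub, norm_mul, norm_pow, Complex.norm_real,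
      Real.norm_of_nonneg (jap_pos a).le] at hdiff
    have h3 : jap a * C ≤ 2 * (1 + T ^ 4) := by nlinarith
    have h5 : jap a ≤ 2 / C * (1 + T ^ 4) := by
      rw [div_mul_eq_mul_div, le_div_iff₀ hC]
      exact h3
    linarith
  · right
    have habs : |a.1| = |k.1| := by
      rw [jap_eq_intCast] at h1
      rw [jap_eq_intCast, jap_eq_intCast] at hjap
      have h1' : max |a.1| 1 ≠ 1 := by exact_mod_cast h1
      have h2' : max |a.1| 1 = max |k.1| 1 := by exact_mod_cast hjap
      omega
    have hneg : mom a = -mom k := by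
      rw [← abs_mom, ← abs_mom] at habs
      exact (abs_eq_abs.1 habs).resolve_left hmom
    have h2 : (momDot (toInt q) : ℝ) = -(2 * mom a) := by
      have : momDot (toInt q) = -(2 * mom a) := by omega
      exact_mod_cast this
    have h3 : jap a = |(mom a : ℝ)| := by
      rw [← Int.cast_abs, abs_mom, Int.cast_abs]
      refine (max_eq_left ?_)
      by_contra hlt
      exact h1 (max_eq_right (not_le.1 hlt).le)
    have h5 := (abs_momDot_toInt_le q).trans (sum_jap_le q)
    rw [h2, abs_neg, abs_mul, ← h3, abs_two] at h5
    nlinarith [sq_nonneg (T ^ 2 - 1)]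

/-! ### The Diophantine weight `∏ᵢ (1 + pᵢ² ⟨i⟩²)` -/

/-- The weight `∏ᵢ (1 + pᵢ² ⟨i⟩²)`. -/
noncomputable def dioWeight (p : Idx →₀ ℤ) : ℝ := p.prod fun i a => 1 + (a : ℝ) ^ 2 * jap i ^ 2

theorem dioWeight_pos (p : Idx →₀ ℤ) : 0 < dioWeight p :=
  Finset.prod_pos fun _ _ => by positivity

theorem dioWeight_rpow (p : Idx →₀ ℤ) (τ : ℝ) :
    dioWeight p ^ τ = p.prod fun i a => (1 + (a : ℝ) ^ 2 * jap i ^ 2) ^ τ :=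
  (Real.finsetProd_rpow _ _ (fun _ _ => by positivity) _).symm

theorem prod_one_div_eq (p : Idx →₀ ℤ) (τ : ℝ) :
    (p.prod fun i a => 1 / (1 + (a : ℝ) ^ 2 * jap i ^ 2) ^ τ) = (dioWeight p ^ τ)⁻¹ := by
  rw [dioWeight_rpow, Finsupp.prod, Finsupp.prod, ← Finset.prod_inv_distrib]
  simp only [one_div]

theorem dioWeight_eq_mul {s : Finset Idx} {p : Idx →₀ ℤ} {i : Idx} (hs : p.support ⊆ insert i s)
    (hi : i ∉ s) : dioWeight p = (1 + (p i : ℝ) ^ 2 * jap i ^ 2) *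
      ∏ j ∈ s, (1 + (p j : ℝ) ^ 2 * jap j ^ 2) := by
  rw [dioWeight, Finsupp.prod_of_support_subset p hs _ (by simp), Finset.prod_insert hi]

/-- Only the factor at i changes, and (p_i + z)² ≤ 2p_i² + 2. -/
theorem dioWeight_add_single_le (p : Idx →₀ ℤ) (i : Idx) {z : ℤ} (hz : z ^ 2 = 1) :
    dioWeight (p + Finsupp.single i z) ≤ 4 * jap i ^ 2 * dioWeight p := by
  have hz' : (z : ℝ) ^ 2 = 1 := by exact_mod_cast hz
  have hi : i ∉ p.support.erase i := Finset.notMem_erase _ _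
  have hsub : p.support ⊆ insert i (p.support.erase i) := Finset.subset_insert_iff.2 subset_rfl
  have hsub' : (p + Finsupp.single i z).support ⊆ insert i (p.support.erase i) := by
    intro j hj
    by_cases hji : j = i
    · exact hji ▸ Finset.mem_insert_self _ _
    · refine Finset.mem_insert_of_mem (Finset.mem_erase.2 ⟨hji, ?_⟩)
      simpa [Ne.symm hji] using hj
  rw [dioWeight_eq_mul hsub hi, dioWeight_eq_mul hsub' hi, ← mul_assoc]
  have e : ∏ j ∈ p.support.erase i, (1 + ((p + Finsupp.single i z) j : ℝ) ^ 2 * jap j ^ 2)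
      = ∏ j ∈ p.support.erase i, (1 + (p j : ℝ) ^ 2 * jap j ^ 2) := by
    refine Finset.prod_congr rfl fun j hj => ?_
    simp [(Finset.ne_of_mem_erase hj).symm]
  rw [e]
  refine mul_le_mul_of_nonneg_right ?_ (Finset.prod_nonneg fun _ _ => by positivity)
  simp only [Finsupp.coe_add, Pi.add_apply, Finsupp.single_eq_same, Int.cast_add]
  have hJ := one_le_pow₀ (one_le_jap i) (n := 2)
  have h1 : ((p i : ℝ) + z) ^ 2 ≤ 2 * (p i : ℝ) ^ 2 + 2 := by
    nlinarith [sq_nonneg ((p i : ℝ) - z)]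
  have h2 : ((p i : ℝ) + z) ^ 2 * jap i ^ 2 ≤ (2 * (p i : ℝ) ^ 2 + 2) * jap i ^ 2 :=
    mul_le_mul_of_nonneg_right h1 (by positivity)
  nlinarith [mul_nonneg (sq_nonneg (p i : ℝ)) (mul_nonneg (sq_nonneg (jap i))
    (sub_nonneg.2 hJ)), mul_nonneg (sq_nonneg (p i : ℝ)) (sq_nonneg (jap i)),
    mul_nonneg (sq_nonneg (p i : ℝ)) (sq_nonneg (jap i ^ 2))]

theorem dioWeight_add_single_sub_single_le (p : Idx →₀ ℤ) (a k : Idx) :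
    dioWeight (p + Finsupp.single a 1 - Finsupp.single k 1)
      ≤ 16 * jap a ^ 2 * jap k ^ 2 * dioWeight p := by
  rw [sub_eq_add_neg, ← Finsupp.single_neg]
  calc _ ≤ 4 * jap k ^ 2 * dioWeight (p + Finsupp.single a 1) :=
        dioWeight_add_single_le _ _ (by norm_num)
    _ ≤ 4 * jap k ^ 2 * (4 * jap a ^ 2 * dioWeight p) := by
        gcongr
        exact dioWeight_add_single_le _ _ (by norm_num)
    _ = _ := by ring

theorem log_one_add_pow_eight_le {u : ℝ} (hu : 0 ≤ u) : Real.log (1 + u ^ 8) ≤ 8 * u := by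
  have h1 : 1 + u ^ 8 ≤ (1 + u) ^ 8 := by
    have := pow_add_pow_le zero_le_one hu (n := 8) (by norm_num)
    simpa using this
  calc Real.log (1 + u ^ 8) ≤ Real.log ((1 + u) ^ 8) := Real.log_le_log (by positivity) h1
    _ = 8 * Real.log (1 + u) := by rw [Real.log_pow]; norm_num
    _ ≤ 8 * u := by
      have := Real.log_le_sub_one_of_pos (x := 1 + u) (by positivity)
      linarith

/-- For u ≥ 32τ/δ the quadratic term suffices; below that, write u = u⁶ u⁻⁵ and bound u⁶ by
(32τ/δ)⁶. The leftover decay u⁻⁵ makes the errors summable over modes, at the price of the power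
δ⁻⁶. -/
theorem linear_le_quadratic_add_inv {τ δ u : ℝ} (hτ : 0 < τ) (hδ : 0 < δ) (hu : 0 < u) :
    8 * τ * u ≤ δ / 4 * u ^ 2 + 8 * τ * (32 * τ) ^ 6 / δ ^ 6 * (u ^ 5)⁻¹ := by
  have h0 : 0 ≤ 8 * τ * (32 * τ) ^ 6 / δ ^ 6 * (u ^ 5)⁻¹ := by positivity
  rcases le_total (32 * τ) (δ * u) with h | h
  · nlinarith
  · have h1 : u ≤ 32 * τ / δ := by rw [le_div_iff₀ hδ]; linarith
    have h2 : 8 * τ * u ≤ 8 * τ * (32 * τ) ^ 6 / δ ^ 6 * (u ^ 5)⁻¹ := by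
      calc 8 * τ * u = 8 * τ * u ^ 6 * (u ^ 5)⁻¹ := by field_simp
        _ ≤ 8 * τ * (32 * τ / δ) ^ 6 * (u ^ 5)⁻¹ := by gcongr
        _ = _ := by rw [div_pow]; ring
    have : 0 ≤ δ / 4 * u ^ 2 := by positivity
    linarith

theorem summable_jap_rpow : Summable fun k : Idx => jap k ^ (-(5 / 4) : ℝ) := by
  have h1 : Summable fun j : ℤ => (max |(j : ℝ)| 1) ^ (-(5 / 4) : ℝ) := by
    refine (Real.summable_abs_int_rpow (b := 5 / 4) (by norm_num)).congr_cofinite ?_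
    filter_upwards [(Set.finite_singleton (0 : ℤ)).compl_mem_cofinite] with j hj
    have : (1 : ℝ) ≤ |(j : ℝ)| := by exact_mod_cast Int.one_le_abs hj
    rw [max_eq_left this]
  rw [← (Equiv.prodComm ℤˣ ℤ).summable_iff]
  refine (summable_prod_of_nonneg fun _ => Real.rpow_nonneg (jap_pos _).le _).2
    ⟨fun _ => h1, (hasSum_fintype _).summable⟩

/-- Take u = √(n√J). Then n²J² ≤ u⁸, so the logarithm is at most 8u, while u² is the mode's share of
the weighted degree and u ≥ J^(1/4) gives u⁻⁵ ≤ J^(-5/4). -/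
theorem rpow_one_add_le {τ δ n J : ℝ} (hτ : 0 < τ) (hδ : 0 < δ) (hn : 1 ≤ n) (hJ : 1 ≤ J) :
    (1 + n ^ 2 * J ^ 2) ^ τ ≤ Real.exp (δ / 4 * (n * √J)
      + 8 * τ * (32 * τ) ^ 6 / δ ^ 6 * J ^ (-(5 / 4) : ℝ)) := by
  set v := √J with hv
  have hv1 : 1 ≤ v := Real.one_le_sqrt.2 hJ
  have hvJ : v ^ 2 = J := Real.sq_sqrt (by positivity)
  set u := √(n * v) with hu
  have hnv : 1 ≤ n * v := one_le_mul_of_one_le_of_one_le hn hv1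
  have hu2 : u ^ 2 = n * v := Real.sq_sqrt (by positivity)
  have hu1 : 1 ≤ u := Real.one_le_sqrt.2 hnv
  have hu0 : 0 < u := by positivity
  have hle : n ^ 2 * J ^ 2 ≤ u ^ 8 := by
    rw [show u ^ 8 = (u ^ 2) ^ 4 by ring, hu2, ← hvJ, mul_pow, ← pow_mul]
    have : n ^ 2 ≤ n ^ 4 := pow_le_pow_right₀ hn (by norm_num)
    gcongr
  have hlog : Real.log (1 + n ^ 2 * J ^ 2) ≤ 8 * u :=
    (Real.log_le_log (by positivity) (by linarith)).trans (log_one_add_pow_eight_le hu0.le)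
  have h5 : (u ^ 5)⁻¹ ≤ J ^ (-(5 / 4) : ℝ) := by
    rw [Real.rpow_neg (by positivity)]
    refine inv_anti₀ (by positivity) ?_
    have h : J ^ (1 / 4 : ℝ) ≤ u := by
      have h4 : J ^ (1 / 4 : ℝ) = √v := by
        rw [hv, Real.sqrt_eq_rpow, Real.sqrt_eq_rpow, ← Real.rpow_mul (by positivity)]
        norm_num
      rw [h4]
      exact Real.sqrt_le_sqrt (le_mul_of_one_le_left (by positivity) hn)
    calc J ^ (5 / 4 : ℝ) = (J ^ (1 / 4 : ℝ)) ^ 5 := by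
          rw [← Real.rpow_natCast, ← Real.rpow_mul (by positivity)]; norm_num
      _ ≤ u ^ 5 := by gcongr
  rw [Real.rpow_def_of_pos (by positivity), Real.exp_le_exp]
  have h6 := linear_le_quadratic_add_inv hτ hδ hu0
  have h7 : 8 * τ * (32 * τ) ^ 6 / δ ^ 6 * (u ^ 5)⁻¹
      ≤ 8 * τ * (32 * τ) ^ 6 / δ ^ 6 * J ^ (-(5 / 4) : ℝ) := by gcongr
  rw [hu2] at h6
  nlinarith

/-- A constant, depending only on `τ`, controlling the Diophantine weight. -/
noncomputable def weightConst (τ : ℝ) : ℝ :=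
  8 * τ * (32 * τ) ^ 6 * ∑' k : Idx, jap k ^ (-(5 / 4) : ℝ)

theorem weightConst_nonneg {τ : ℝ} (hτ : 0 < τ) : 0 ≤ weightConst τ :=
  mul_nonneg (by positivity) (tsum_nonneg fun k => Real.rpow_nonneg (jap_pos k).le _)

theorem dioWeight_toInt_rpow_le {τ δ : ℝ} (hτ : 0 < τ) (hδ : 0 < δ) (q : Idx →₀ ℕ) :
    dioWeight (toInt q) ^ τ ≤ Real.exp (δ / 4 * sqrtDeg q + weightConst τ / δ ^ 6) := by
  rw [dioWeight_rpow, toInt, Finsupp.prod_mapRange_index (by simp), Finsupp.prod]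
  calc _ ≤ ∏ i ∈ q.support, Real.exp (δ / 4 * (q i * √(jap i))
      + 8 * τ * (32 * τ) ^ 6 / δ ^ 6 * jap i ^ (-(5 / 4) : ℝ)) := by
        refine Finset.prod_le_prod (fun _ _ => by positivity) fun i hi => ?_
        have h1 : (1 : ℝ) ≤ q i := by
          exact_mod_cast Nat.one_le_iff_ne_zero.2 (Finsupp.mem_support_iff.1 hi)
        simpa using rpow_one_add_le hτ hδ h1 (one_le_jap i)
    _ = Real.exp (δ / 4 * sqrtDeg q + 8 * τ * (32 * τ) ^ 6 / δ ^ 6 *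
          ∑ i ∈ q.support, jap i ^ (-(5 / 4) : ℝ)) := by
        rw [← Real.exp_sum, Finset.sum_add_distrib, ← Finset.mul_sum, ← Finset.mul_sum]
        rfl
    _ ≤ _ := by
        rw [Real.exp_le_exp, weightConst, mul_div_right_comm (8 * τ * (32 * τ) ^ 6)]
        gcongr
        exact summable_jap_rpow.sum_le_tsum _ fun k _ => Real.rpow_nonneg (jap_pos k).le _

/-- With u = √T the logarithm is at most 8u, and completing the square absorbs 32τu into δT/4 plus
1024τ²/δ. The exponent 4τ comes from the factor ⟨a⟩²⟨k⟩² in the weight. -/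
theorem one_add_pow_four_rpow_le {τ δ T : ℝ} (hτ : 0 < τ) (hδ : 0 < δ) (hT : 0 ≤ T) :
    (1 + T ^ 4) ^ (4 * τ)
      ≤ Real.exp (δ / 4 * T) * Real.exp (1024 * τ ^ 2 + 1024 * τ ^ 2 / δ ^ 6) := by
  set u := √T with hu
  have hu0 : 0 ≤ u := Real.sqrt_nonneg T
  have hu2 : u ^ 2 = T := Real.sq_sqrt hT
  have hlog : Real.log (1 + T ^ 4) ≤ 8 * u := by
    rw [← hu2, ← pow_mul]
    exact log_one_add_pow_eight_le hu0
  have h1 : 32 * τ * u ≤ δ / 4 * u ^ 2 + 1024 * τ ^ 2 / δ := by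
    have : δ / 4 * u ^ 2 + 1024 * τ ^ 2 / δ - 32 * τ * u = (δ * u - 64 * τ) ^ 2 / (4 * δ) := by
      field_simp
      ring
    have : 0 ≤ (δ * u - 64 * τ) ^ 2 / (4 * δ) := by positivity
    linarith
  have h2 : 1 / δ ≤ 1 + 1 / δ ^ 6 := by
    rw [← one_div_pow]
    have hd : 0 < 1 / δ := by positivity
    rcases le_total (1 / δ) 1 with h | h
    · have : 0 ≤ (1 / δ) ^ 6 := by positivity
      linarith
    · have := le_self_pow₀ h (n := 6) (by norm_num)
      linarith
  have h3 : 1024 * τ ^ 2 / δ ≤ 1024 * τ ^ 2 + 1024 * τ ^ 2 / δ ^ 6 := by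
    have := mul_le_mul_of_nonneg_left h2 (by positivity : 0 ≤ 1024 * τ ^ 2)
    simpa only [mul_add, mul_one_div, mul_one] using this
  rw [← Real.exp_add, Real.rpow_def_of_pos (by positivity), Real.exp_le_exp]
  rw [hu2] at h1
  nlinarith

/-! ### The small divisor estimate -/

theorem IsDiophantine.inv_norm_le {lam : Idx → ℂ} {γ τ : ℝ} (hγ : 0 < γ)
    (h : IsDiophantine lam γ τ) {p : Idx →₀ ℤ} {k : Idx} (hp : freqDot lam p ≠ 0)
    (hm : momDot p = 0) (hk : 0 ≤ p + Finsupp.single k 1) :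
    ‖freqDot lam p‖⁻¹ ≤ γ⁻¹ * dioWeight p ^ τ := by
  have h1 := h p (fun hr => hp hr.1) hm ⟨k, hk⟩
  rw [prod_one_div_eq] at h1
  have hw : 0 < dioWeight p ^ τ := Real.rpow_pos_of_pos (dioWeight_pos p) τ
  have h2 := inv_anti₀ (by positivity) h1
  rwa [mul_inv, inv_inv] at h2

/-- The Diophantine condition at e_(0,1), which has zero momentum and weight 2, bounds γ above
because |λ_(0,1)| ≤ 3/2. Divisors of size at least 1 can therefore also be charged to γ⁻¹. -/
theorem IsDiophantine.one_le {lam : Idx → ℂ} {γ τ C : ℝ} (hγ : 0 < γ) (h0 : ∀ k, lam k ≠ 0)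
    (hlam : IsSuperlinear lam C) (h : IsDiophantine lam γ τ) :
    1 ≤ γ⁻¹ * (3 / 2 * 2 ^ τ) := by
  obtain ⟨φ, hφ, -⟩ := hlam
  set k : Idx := (0, 1)
  have hj : jap k = 1 := by simp [jap, k]
  have h1 := h.inv_norm_le hγ (p := Finsupp.single k 1) (k := k)
    (by rw [freqDot_single]; exact h0 k) (by rw [momDot_single]; simp [mom, k])
    (add_nonneg (Finsupp.single_nonneg.2 zero_le_one) (Finsupp.single_nonneg.2 zero_le_one))
  have hw : dioWeight (Finsupp.single k 1) = 2 := by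
    rw [dioWeight, Finsupp.prod_single_index (by simp), hj]; norm_num
  rw [freqDot_single, hw] at h1
  have h2 := norm_le_of_superlinear (hφ k)
  rw [hj] at h2
  have hpos : 0 < ‖lam k‖ := norm_pos_iff.2 (h0 k)
  calc (1 : ℝ) = ‖lam k‖⁻¹ * ‖lam k‖ := (inv_mul_cancel₀ hpos.ne').symm
    _ ≤ (γ⁻¹ * 2 ^ τ) * (3 / 2 * 1 ^ 2) := by gcongr
    _ = _ := by ring

/-- The multiplicative constant in the small divisor estimate. -/
noncomputable def divisorConst (τ C : ℝ) : ℝ :=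
  3 / 2 * 2 ^ τ + (1 + (16 * (2 + 2 / C) ^ 4) ^ τ) * Real.exp (1024 * τ ^ 2)

theorem divisorConst_pos (τ : ℝ) {C : ℝ} (hC : 0 < C) : 0 < divisorConst τ C := by
  unfold divisorConst; positivity

theorem inv_norm_freqDot_le {τ C γ : ℝ} (hτ : 0 < τ) (hC : 0 < C) (hγ : 0 < γ) {lam : Idx → ℂ}
    (h0 : ∀ k, lam k ≠ 0) (hlam : IsSuperlinear lam C) (hdio : IsDiophantine lam γ τ)
    {δ : ℝ} (hδ : 0 < δ) {q : Idx →₀ ℕ} {k : Idx} (hq : q ≠ 0)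
    (hm : momDot (subUnit q k) = 0) (hf : freqDot lam (subUnit q k) ≠ 0) :
    ‖freqDot lam (subUnit q k)‖⁻¹
      ≤ divisorConst τ C * Real.exp ((weightConst τ + 1024 * τ ^ 2) / δ ^ 6) * γ⁻¹
        * Real.exp (δ * (sqrtDeg q - √(jap k))) := by
  obtain ⟨a, ha, hmax⟩ := q.support.exists_max_image jap (Finsupp.support_nonempty_iff.2 hq)
  have hle : Finsupp.single a 1 ≤ q := by
    rw [Finsupp.single_le_iff]
    exact Nat.one_le_iff_ne_zero.2 (Finsupp.mem_support_iff.1 ha)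
  -- From here on `q` denotes what remains after removing one copy of the largest index.
  obtain ⟨q, rfl⟩ : ∃ q', q = q' + Finsupp.single a 1 := ⟨_, (tsub_add_cancel_of_le hle).symm⟩
  have hmax' : ∀ i ∈ q.support, jap i ≤ jap a := fun i hi => hmax i <|
    Finsupp.support_mono le_self_add hi
  rw [subUnit_add_single] at *
  have hT := sqrtDeg_nonneg q
  have hD : sqrtDeg q / 2 ≤ sqrtDeg (q + Finsupp.single a 1) - √(jap k) := by
    rw [sqrtDeg_add_single]
    have := sqrt_jap_le_of_momDot hmax' hm
    linarith
  set D := sqrtDeg (q + Finsupp.single a 1) - √(jap k)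
  set p := toInt q + Finsupp.single a 1 - Finsupp.single k 1 with hp
  have hA := weightConst_nonneg hτ
  set A := weightConst τ
  set E := Real.exp ((A + 1024 * τ ^ 2) / δ ^ 6) with hE
  set G := Real.exp (1024 * τ ^ 2) with hG
  set F := Real.exp (δ * D) with hF
  set N := (16 * (2 + 2 / C) ^ 4) ^ τ with hN
  have hN0 : 0 ≤ N := by positivity
  have hE1 : 1 ≤ E := Real.one_le_exp (by positivity)
  have hG1 : 1 ≤ G := Real.one_le_exp (by positivity)
  have hF1 : 1 ≤ F := Real.one_le_exp (by nlinarith)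
  -- The three summands pay respectively for a divisor of size at least 1, for cancellation of λ_a
  -- and λ_k, and for ⟨a⟩, ⟨k⟩ bounded by the remainder.
  have hfin : divisorConst τ C * E * γ⁻¹ * F
      = 3 / 2 * 2 ^ τ * E * γ⁻¹ * F + γ⁻¹ * (G * E * F) + γ⁻¹ * (N * (G * E * F)) := by
    rw [divisorConst]; ring
  have hpos1 : 0 ≤ 3 / 2 * (2 : ℝ) ^ τ * E * γ⁻¹ * F := by positivity
  have hpos2 : 0 ≤ γ⁻¹ * (G * E * F) := by positivity
  have hpos3 : 0 ≤ γ⁻¹ * (N * (G * E * F)) := by positivity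
  rw [hfin]
  have hq1 : dioWeight (toInt q) ^ τ ≤ Real.exp (δ / 4 * sqrtDeg q + A / δ ^ 6) :=
    dioWeight_toInt_rpow_le hτ hδ q
  rcases le_or_gt 1 ‖freqDot lam p‖ with hbig | hsmall
  · have h1 := hdio.one_le hγ h0 hlam
    have h2 : 1 ≤ 3 / 2 * (2 : ℝ) ^ τ * E * γ⁻¹ * F := by
      calc (1 : ℝ) ≤ γ⁻¹ * (3 / 2 * 2 ^ τ) * (E * F) :=
            one_le_mul_of_one_le_of_one_le h1 (one_le_mul_of_one_le_of_one_le hE1 hF1)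
        _ = _ := by ring
    have := inv_le_one_of_one_le₀ hbig
    linarith
  -- The budget: `hD` makes δD at least half of δ times the remaining degree.
  have hGE : ∀ x, x ≤ δ / 2 * sqrtDeg q + A / δ ^ 6 + (1024 * τ ^ 2 + 1024 * τ ^ 2 / δ ^ 6) →
      Real.exp x ≤ G * E * F := by
    intro x hx
    rw [hE, hG, hF, ← Real.exp_add, ← Real.exp_add, Real.exp_le_exp, add_div]
    nlinarith
  have h6 : 0 ≤ 1024 * τ ^ 2 / δ ^ 6 := by positivity
  rcases cancel_or_jap_le hC hlam hm hsmall with ⟨hl, hmom⟩ | ⟨hja, hjk⟩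
  · have hfq : freqDot lam p = freqDot lam (toInt q) := by
      rw [hp, freqDot_sub, freqDot_add, freqDot_single, freqDot_single, hl, add_sub_cancel_right]
    have hmq : momDot (toInt q) = 0 := by
      rwa [hp, momDot_sub, momDot_add, momDot_single, momDot_single, hmom,
        add_sub_cancel_right] at hm
    rw [hfq] at hf ⊢
    have h1 := hdio.inv_norm_le hγ hf hmq (k := k)
      (add_nonneg (toInt_nonneg q) (Finsupp.single_nonneg.2 zero_le_one))
    have h2 : Real.exp (δ / 4 * sqrtDeg q + A / δ ^ 6) ≤ G * E * F := hGE _ (by nlinarith)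
    have h3 : γ⁻¹ * dioWeight (toInt q) ^ τ ≤ γ⁻¹ * (G * E * F) := by
      gcongr
      exact hq1.trans h2
    linarith
  · have hk0 : 0 ≤ p + Finsupp.single k 1 := by
      rw [hp, sub_add_cancel]
      exact add_nonneg (toInt_nonneg q) (Finsupp.single_nonneg.2 zero_le_one)
    have h1 := hdio.inv_norm_le hγ hf hm hk0
    set M := 2 + 2 / C
    set S := 1 + sqrtDeg q ^ 4
    have hM0 : 0 ≤ M := by positivity
    have hS0 : 0 ≤ S := by positivity
    have hja0 := (jap_pos a).le
    have hjk0 := (jap_pos k).le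
    have hw : dioWeight p ≤ (16 * M ^ 4) * S ^ 4 * dioWeight (toInt q) := by
      refine (dioWeight_add_single_sub_single_le (toInt q) a k).trans ?_
      have := (dioWeight_pos (toInt q)).le
      calc 16 * jap a ^ 2 * jap k ^ 2 * dioWeight (toInt q)
          ≤ 16 * (M * S) ^ 2 * (M * S) ^ 2 * dioWeight (toInt q) := by gcongr
        _ = _ := by ring
    have hw2 : dioWeight p ^ τ ≤ N * (G * E * F) := by
      have hS : (S ^ 4) ^ τ = S ^ (4 * τ) := by
        rw [Real.rpow_mul hS0]; norm_cast
      calc dioWeight p ^ τ ≤ ((16 * M ^ 4) * S ^ 4 * dioWeight (toInt q)) ^ τ :=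
            Real.rpow_le_rpow (dioWeight_pos p).le hw hτ.le
        _ = N * (S ^ (4 * τ) * dioWeight (toInt q) ^ τ) := by
            rw [Real.mul_rpow (by positivity) (dioWeight_pos _).le,
              Real.mul_rpow (by positivity) (by positivity), hS, mul_assoc]
        _ ≤ N * ((Real.exp (δ / 4 * sqrtDeg q)
              * Real.exp (1024 * τ ^ 2 + 1024 * τ ^ 2 / δ ^ 6))
              * Real.exp (δ / 4 * sqrtDeg q + A / δ ^ 6)) := by
            have := (Real.rpow_pos_of_pos (dioWeight_pos (toInt q)) τ).le
            gcongr
            exact one_add_pow_four_rpow_le hτ hδ hT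
        _ ≤ N * (G * E * F) := by
            rw [← Real.exp_add, ← Real.exp_add]
            exact mul_le_mul_of_nonneg_left (hGE _ (by linarith)) hN0
    have h3 : γ⁻¹ * dioWeight p ^ τ ≤ γ⁻¹ * (N * (G * E * F)) := by gcongr
    linarith

/-! ### Rescaling of majorant norms -/

/-- The dilation `x_k ↦ e^{δ √⟨k⟩} x_k`, which maps `g_{s+δ}` isometrically onto `g_s`. -/
noncomputable def dilate (δ : ℝ) (x : Idx → ℂ) (k : Idx) : ℂ := (Real.exp (δ * √(jap k)) : ℂ) * x k

theorem enorm_dilate (δ : ℝ) (x : Idx → ℂ) (k : Idx) :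
    ‖dilate δ x k‖ₑ = ENNReal.ofReal (Real.exp (δ * √(jap k))) * ‖x k‖ₑ := by
  rw [dilate, enorm_mul, ← ofReal_norm, Complex.norm_real,
    Real.norm_of_nonneg (Real.exp_pos _).le]

theorem prod_enorm_dilate (δ : ℝ) (x : Idx → ℂ) (q : Idx →₀ ℕ) :
    (q.prod fun h n => ‖dilate δ x h‖ₑ ^ n)
      = ENNReal.ofReal (Real.exp (δ * sqrtDeg q)) * q.prod fun h n => ‖x h‖ₑ ^ n := by
  simp only [Finsupp.prod, enorm_dilate, mul_pow, Finset.prod_mul_distrib]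
  congr 1
  rw [sqrtDeg, Finsupp.sum, Finset.mul_sum, Real.exp_sum,
    ENNReal.ofReal_prod_of_nonneg fun _ _ => (Real.exp_pos _).le]
  refine Finset.prod_congr rfl fun i _ => ?_
  rw [← ENNReal.ofReal_pow (Real.exp_pos _).le, ← Real.exp_nat_mul]
  congr 2
  ring

theorem gNorm_add (s δ : ℝ) (a : Idx → ℝ≥0∞) :
    gNorm (s + δ) a = gNorm s fun k => ENNReal.ofReal (Real.exp (δ * √(jap k))) * a k := by
  unfold gNorm
  congr 1
  refine tsum_congr fun k => ?_
  rw [mul_pow, ← mul_assoc, ← ENNReal.ofReal_pow (Real.exp_pos _).le,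
    ← ENNReal.ofReal_mul (by positivity), mul_assoc (jap k ^ 2), ← Real.exp_nat_mul, ← Real.exp_add]
  congr 4
  push_cast
  ring

theorem gNorm_mono (s : ℝ) {a b : Idx → ℝ≥0∞} (h : ∀ k, a k ≤ b k) : gNorm s a ≤ gNorm s b := by
  unfold gNorm
  gcongr with k
  exact h k

theorem gNorm_const_mul (s : ℝ) (c : ℝ≥0∞) (a : Idx → ℝ≥0∞) :
    gNorm s (fun k => c * a k) = c * gNorm s a := by
  unfold gNorm
  have : ∀ k, ENNReal.ofReal (jap k ^ 2 * Real.exp (2 * s * √(jap k))) * (c * a k) ^ 2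
      = c ^ 2 * (ENNReal.ofReal (jap k ^ 2 * Real.exp (2 * s * √(jap k))) * a k ^ 2) := by
    intro k; ring
  simp_rw [this]
  rw [ENNReal.tsum_mul_left, ENNReal.mul_rpow_of_nonneg _ _ (by norm_num), ← ENNReal.rpow_natCast,
    ← ENNReal.rpow_mul]
  norm_num

theorem dilate_mem_gBall {s δ r : ℝ} {x : Idx → ℂ} (hx : x ∈ gBall (s + δ) r) :
    dilate δ x ∈ gBall s r := by
  simp only [gBall, Set.mem_ofPred_eq, enorm_dilate] at *
  rwa [← gNorm_add]

/-- Comparison of majorant norms on different spaces, from a bound on the coefficients. -/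
theorem majNorm_add_le {s δ r κ : ℝ} {X Y : FormalVF} (h : ∀ k q,
    ‖MvPowerSeries.coeff q (X k)‖ ≤ κ * Real.exp (δ * (sqrtDeg q - √(jap k)))
      * ‖MvPowerSeries.coeff q (Y k)‖) :
    majNorm (s + δ) r X ≤ ENNReal.ofReal κ * majNorm s r Y := by
  -- Evaluating Y at the dilated point supplies exp(δ ∑ q_i √⟨i⟩), and the stronger output norm
  -- costs exp(δ√⟨k⟩); their quotient is the factor allowed in `h`.
  have hmaj : ∀ x k, ENNReal.ofReal (Real.exp (δ * √(jap k))) * majorant X x k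
      ≤ ENNReal.ofReal κ * majorant Y (dilate δ x) k := by
    intro x k
    unfold majorant
    rw [← ENNReal.tsum_mul_left, ← ENNReal.tsum_mul_left]
    refine ENNReal.tsum_le_tsum fun q => ?_
    rw [prod_enorm_dilate, ← mul_assoc, ← mul_assoc, ← mul_assoc]
    gcongr ?_ * _
    rw [← ofReal_norm, ← ofReal_norm, ← ENNReal.ofReal_mul (Real.exp_pos _).le,
      ← ENNReal.ofReal_mul' (norm_nonneg _), ← ENNReal.ofReal_mul' (Real.exp_pos _).le]
    refine ENNReal.ofReal_le_ofReal ?_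
    calc _ ≤ Real.exp (δ * √(jap k)) * (κ * Real.exp (δ * (sqrtDeg q - √(jap k)))
          * ‖MvPowerSeries.coeff q (Y k)‖) := by gcongr; exact h k q
      _ = κ * ‖MvPowerSeries.coeff q (Y k)‖ *
          (Real.exp (δ * √(jap k)) * Real.exp (δ * (sqrtDeg q - √(jap k)))) := by ring
      _ = _ := by rw [← Real.exp_add]; congr 2; ring
  unfold majNorm
  rw [mul_left_comm]
  gcongr
  refine iSup₂_le fun x hx => ?_
  calc gNorm (s + δ) (majorant X x)
      = gNorm s fun k => ENNReal.ofReal (Real.exp (δ * √(jap k))) * majorant X x k := gNorm_add _ _ _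
    _ ≤ gNorm s fun k => ENNReal.ofReal κ * majorant Y (dilate δ x) k := gNorm_mono s (hmaj x)
    _ = ENNReal.ofReal κ * gNorm s (majorant Y (dilate δ x)) := gNorm_const_mul _ _ _
    _ ≤ _ := by
      gcongr
      exact le_iSup₂ (f := fun y (_ : y ∈ gBall s r) => gNorm s (majorant Y y)) _
        (dilate_mem_gBall hx)

/-! ### The homological equation -/

/-- The solution of `L_lam X = Y` without resonant monomials. -/
noncomputable def solveDiag (lam : Idx → ℂ) (Y : FormalVF) : FormalVF :=
  fun k q => (freqDot lam (subUnit q k))⁻¹ * MvPowerSeries.coeff q (Y k)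

theorem coeff_solveDiag (lam : Idx → ℂ) (Y : FormalVF) (k : Idx) (q : Idx →₀ ℕ) :
    MvPowerSeries.coeff q (solveDiag lam Y k)
      = (freqDot lam (subUnit q k))⁻¹ * MvPowerSeries.coeff q (Y k) := rfl

theorem lieDiag_solveDiag {lam : Idx → ℂ} {Y : FormalVF}
    (hY : ∀ k q, freqDot lam (subUnit q k) = 0 → MvPowerSeries.coeff q (Y k) = 0) :
    lieDiag lam (solveDiag lam Y) = Y := by
  funext k
  ext q
  rw [coeff_lieDiag, coeff_solveDiag]
  by_cases h : freqDot lam (subUnit q k) = 0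
  · rw [hY k q h, mul_zero, mul_zero]
  · rw [mul_inv_cancel_left₀ h]

theorem eq_solveDiag {lam : Idx → ℂ} {X : FormalVF}
    (hX : ∀ k q, freqDot lam (subUnit q k) = 0 → MvPowerSeries.coeff q (X k) = 0) :
    X = solveDiag lam (lieDiag lam X) := by
  funext k
  ext q
  rw [coeff_solveDiag, coeff_lieDiag]
  by_cases h : freqDot lam (subUnit q k) = 0
  · rw [hX k q h, mul_zero, mul_zero]
  · rw [inv_mul_cancel_left₀ h]

end AnalyticVF

theorem proposition4p2 (τ : ℝ) (hτ : 0 < τ) (C : ℝ) (hC : 0 < C) :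
    ∃ c > (0 : ℝ), ∃ K > (0 : ℝ),
      ∀ (γ : ℝ), 0 < γ → ∀ lam : Idx → ℂ, (∀ k, lam k ≠ 0) →
        IsSuperlinear lam C → IsDiophantine lam γ τ →
      ∀ s r : ℝ, 0 < s → 0 < r → ∀ Y ∈ rangeSpace lam s r,
        ∃ X : FormalVF, lieDiag lam X = Y ∧
          ∀ δ : ℝ, 0 < δ →
            X ∈ rangeSpace lam (s + δ) r ∧
            (∀ X' ∈ rangeSpace lam (s + δ) r, lieDiag lam X' = Y → X' = X) ∧
            majNorm (s + δ) r X
              ≤ ENNReal.ofReal (K * Real.exp (c / δ ^ 6) * γ⁻¹) * majNorm s r Y := by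
  refine ⟨weightConst τ + 1024 * τ ^ 2, add_pos_of_nonneg_of_pos (weightConst_nonneg hτ)
    (by positivity), divisorConst τ C, divisorConst_pos τ hC, ?_⟩
  rintro γ hγ lam h0 hlam hdio s r - - Y ⟨⟨hY0, hYm, hYn⟩, hYr⟩
  -- The solution does not involve δ, so a single X serves every δ.
  refine ⟨solveDiag lam Y, lieDiag_solveDiag hYr, fun δ hδ => ?_⟩
  have hle : majNorm (s + δ) r (solveDiag lam Y)
      ≤ ENNReal.ofReal (divisorConst τ C * Real.exp ((weightConst τ + 1024 * τ ^ 2) / δ ^ 6) * γ⁻¹)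
        * majNorm s r Y := by
    refine majNorm_add_le fun k q => ?_
    rw [coeff_solveDiag, norm_mul, norm_inv]
    by_cases hz : MvPowerSeries.coeff q (Y k) = 0
    · simp [hz]
    · refine mul_le_mul_of_nonneg_right ?_ (norm_nonneg _)
      refine inv_norm_freqDot_le hτ hC hγ h0 hlam hdio hδ ?_ ?_ fun h => hz (hYr k q h)
      -- Vanishing at the origin excludes q = 0, so a largest input index exists.
      · rintro rfl
        exact hz (hY0 k)
      · exact not_not.1 fun h => hz (hYm k q h)
  refine ⟨⟨⟨fun k => ?_, fun k q h => ?_, ?_⟩, fun k q h => ?_⟩, ?_, hle⟩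
  · rw [coeff_solveDiag, hY0, mul_zero]
  · rw [coeff_solveDiag, hYm k q h, mul_zero]
  · exact hle.trans_lt (ENNReal.mul_lt_top ENNReal.ofReal_lt_top hYn)
  · rw [coeff_solveDiag, hYr k q h, mul_zero]
  · rintro X' ⟨-, hX'⟩ hL
    rw [eq_solveDiag hX', hL]
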